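/- Consider a slotted-time downlink C-RAN with RRHs $k\in\mathcal K=\{1,\dots,K\}$ ($M$ antennas each) and UEs $i\in\mathcal I=\{1,\dots,I\}$ ($N$ antennas each), bandwidth $W>0$, slot duration $\tau>0$, noise variance $\sigma^2>0$, drain efficiencies $\eta_k>0$, static powers $P_k^c\ge 0$ and power budgets $P_k\ge 0$. In slot $t$ the controller observes the channel matrices $\mathbf H_i(t)\in\mathbb C^{N\times MK}$ and chooses a set $\mathcal A(t)\subseteq\mathcal K$ of active RRHs and beamformers $\mathbf w_i(t)=(\mathbf w_{1i}(t),\dots,\mathbf w_{Ki}(t))\in\mathbb C^{MK}$, $i\in\mathcal I$. A choice is feasible if $\|\tilde{\mathbf w}_k\|_2^2:=\sum_i\|\mathbf w_{ki}\|_2^2\le P_k$ for all $k$ and $\tilde{\mathbf w}_k=0$ for $k\notin\mathcal A(t)$. The service of queue $i$ is $$\mu_i(t)=W\tau\log_2\det\Big(\mathbf I+\mathbf H_i\mathbf w_i\mathbf w_i^H\mathbf H_i^H\Big(\sum_{j\ne i}\mathbf H_i\mathbf w_j\mathbf w_j^H\mathbf H_i^H+\sigma^2\mathbf I\Big)^{-1}\Big),$$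 the network power is $p(\mathcal A,\mathbf w)=\sum_{k\in\mathcal A}\big(\tfrac1{\eta_k}\|\tilde{\mathbf w}_k\|_2^2+P_k^c\big)$, and the queues evolve by $Q_i(t+1)=\max[Q_i(t)-\mu_i(t),0]+A_i(t)$, where $Q_i(0)\ge 0$ has finite second moment. The channel states $\mathbf H(t)$ are i.i.d. over slots with a given law. The arrivals $A_i(t)\ge 0$ are independent over $i$, i.i.d. over slots, with means $\lambda_i$ and finite second moments, and $(\mathbf H(t),\mathbf A(t))$ is independent of everything that happened before slot $t$ and of the randomization used in slot $t$. Decisions are non-anticipating: those of slot $t$ depend only on the past, on randomization, and on $\mathbf H(t)$. Assume that, for each $i$, the square of the largest value of $\mu_i(t)$ over feasible choices has finite expectation under the channel law. The queues are strongly stable if $\limsup_{T\to\infty}\frac1T\sum_{t=0}^{T-1}\mathbb E[Q_i(t)]<\infty$ for every $i$. The maximum stability region $\mathcal C$ is the closure of the set of arrival-rate vectors $\boldsymbol\lambda$ for which some arrivals with these rates and some feasible non-anticipating, possibly randomized, policy give strongly stable queues. Fix $V>0$, and let $(\mathcal A(t),\mathbf w(t))$ in every slot be an optimal solution, over all feasible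 choices, of $$\text{(P1)}\qquad \max_{\mathcal A,\mathbf w}\ \sum_{i\in\mathcal I}Q_i(t)\mu_i(t)-V\,p(\mathcal A,\mathbf w).$$ Then this control achieves the maximum stability region: the closure of the set of arrival-rate vectors which it stabilizes (that is, for which the network can be operated in this way, and is strongly stable whenever it is) equals $\mathcal C$. Moreover, for every $\boldsymbol\lambda$ such that $\boldsymbol\lambda+\epsilon\mathbf 1\in\mathcal C$ for some $\epsilon>0$, all queues are strongly stable under this control, for all arrivals with rate vector $\boldsymbol\lambda$. -/

import Mathlib

open MeasureTheory ProbabilityTheory Filter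
open scoped ENNReal Matrix

/-- Physical parameters of a downlink C-RAN with `K` remote radio heads (RRHs). -/
structure CRAN (K : ℕ) where
  /-- bandwidth -/
  W : ℝ
  /-- slot duration -/
  τ : ℝ
  /-- noise standard deviation: the noise covariance is `σ ^ 2` times the identity -/
  σ : ℝ
  /-- drain efficiency of the power amplifier of each RRH -/
  η : Fin K → ℝ
  /-- transmit power budget of each RRH -/
  Pmax : Fin K → ℝ
  /-- static power consumption of each active RRH with its fronthaul link -/
  Pc : Fin K → ℝ
  W_pos : 0 < W
  τ_pos : 0 < τ
  σ_pos : 0 < σ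
  η_pos : ∀ k, 0 < η k
  Pmax_nonneg : ∀ k, 0 ≤ Pmax k
  Pc_nonneg : ∀ k, 0 ≤ Pc k

/-- The network channel state: for each UE `i` the `N × KM` matrix `H_i = [H_1i, …, H_Ki]`, whose
column `(k, m)` belongs to antenna `m` of RRH `k`. -/
abbrev ChannelState (K I M N : ℕ) : Type :=
  Fin I → Fin N → Fin K × Fin M → ℂ

/-- The network beamformer: for each UE `i` the aggregated vector `w_i = (w_1i, …, w_Ki)`. -/
abbrev Beamformer (K I M : ℕ) : Type :=
  Fin I → Fin K × Fin M → ℂ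

namespace CRAN

variable {K I M N : ℕ}

/-- The covariance matrix `H_i w_j w_jᴴ H_iᴴ` at UE `i` of the signal intended for UE `j`. -/
noncomputable def signalCov (h : ChannelState K I M N) (w : Beamformer K I M) (i j : Fin I) :
    Matrix (Fin N) (Fin N) ℂ :=
  Matrix.of (h i) * Matrix.vecMulVec (w j) (star (w j)) * (Matrix.of (h i))ᴴ

/-- Interference plus noise covariance matrix at UE `i`. -/
noncomputable def noiseCov (S : CRAN K) (h : ChannelState K I M N) (w : Beamformer K I M)
    (i : Fin I) : Matrix (Fin N) (Fin N) ℂ :=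
  (∑ j ∈ Finset.univ.erase i, signalCov h w i j)
    + ((S.σ ^ 2 : ℝ) : ℂ) • (1 : Matrix (Fin N) (Fin N) ℂ)

/-- Achievable rate `R_i` of UE `i` in bps/Hz, interference being treated as noise
(the determinant is a real number, at least `1`). -/
noncomputable def rate (S : CRAN K) (h : ChannelState K I M N) (w : Beamformer K I M)
    (i : Fin I) : ℝ :=
  Real.logb 2 (1 + signalCov h w i i * (S.noiseCov h w i)⁻¹).det.re

/-- Amount of traffic `μ_i = W τ R_i` that can depart from queue `i` in one slot. -/
noncomputable def service (S : CRAN K) (h : ChannelState K I M N) (w : Beamformer K I M)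
    (i : Fin I) : ℝ :=
  S.W * S.τ * S.rate h w i

/-- Squared norm of the aggregated beamformer used by RRH `k`. -/
noncomputable def rrhPower (w : Beamformer K I M) (k : Fin K) : ℝ :=
  ∑ i, ∑ m, ‖w i (k, m)‖ ^ 2

/-- Network power consumption with active set `a` and beamformer `w`. -/
noncomputable def networkPower (S : CRAN K) (a : Finset (Fin K)) (w : Beamformer K I M) : ℝ :=
  ∑ k ∈ a, (1 / S.η k * rrhPower w k + S.Pc k)

/-- A pair (active set, beamformer) is feasible if every RRH meets its power budget and
RRHs that are switched off do not transmit. -/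
def Feasible (S : CRAN K) (a : Finset (Fin K)) (w : Beamformer K I M) : Prop :=
  (∀ k, rrhPower w k ≤ S.Pmax k) ∧ ∀ k, k ∉ a → ∀ i m, w i (k, m) = 0

/-- Objective of the per-slot problem, for queue lengths `q` and channel state `h`. -/
noncomputable def objective (S : CRAN K) (V : ℝ) (q : Fin I → ℝ) (h : ChannelState K I M N)
    (a : Finset (Fin K)) (w : Beamformer K I M) : ℝ :=
  ∑ i, q i * S.service h w i - V * S.networkPower a w

/-- `(a, w)` is an optimal solution of the per-slot problem: it maximizes the objective over all
feasible pairs. -/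
def SolvesP1 (S : CRAN K) (V : ℝ) (q : Fin I → ℝ) (h : ChannelState K I M N)
    (a : Finset (Fin K)) (w : Beamformer K I M) : Prop :=
  S.Feasible a w ∧
    ∀ (a' : Finset (Fin K)) (w' : Beamformer K I M), S.Feasible a' w' →
      S.objective V q h a' w' ≤ S.objective V q h a w

/-- The service rates have finite second moments, uniformly over all control decisions: for each
UE, the square of the largest feasible service has finite expectation. -/
def FiniteServiceMoments (S : CRAN K) (ν : Measure (ChannelState K I M N)) : Prop :=
  ∀ i, ∫⁻ h, ⨆ (a : Finset (Fin K)) (w : Beamformer K I M) (_ : S.Feasible a w),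
    ENNReal.ofReal (S.service h w i ^ 2) ∂ν < ⊤

/-- The processes of channel states `H`, arrivals `A`, queues `Q`, active sets `a` and
beamformers `w` on the probability space `(Ω, P)` form a C-RAN operated by a feasible
non-anticipating (possibly randomized) control policy, with channel law `ν` and arrival rate
vector `lam`. The σ-algebra `𝓖 t` is the information available just before the channel of slot `t`
is observed, including any randomization used in slot `t`. -/
structure IsControlled (S : CRAN K) (ν : Measure (ChannelState K I M N)) (lam : Fin I → ℝ)
    {Ω : Type*} {mΩ : MeasurableSpace Ω} (P : Measure Ω) (𝓖 : Filtration ℕ mΩ)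
    (H : ℕ → Ω → ChannelState K I M N) (A Q : ℕ → Ω → Fin I → ℝ)
    (a : ℕ → Ω → Finset (Fin K)) (w : ℕ → Ω → Beamformer K I M) : Prop where
  /-- the past is known -/
  meas_channel : ∀ t, Measurable[𝓖 (t + 1)] (H t)
  meas_arrival : ∀ t, Measurable[𝓖 (t + 1)] (A t)
  /-- channel and arrivals of slot `t` are independent of the past; with the two preceding fields
  this makes them independent over slots -/
  indep_past : ∀ t, Indep
    (MeasurableSpace.comap (fun ω => (H t ω, A t ω)) inferInstance) (𝓖 t) P
  /-- the channel states are identically distributed over slots -/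
  law_channel : ∀ t, P.map (H t) = ν
  /-- the arrivals are identically distributed over slots, nonnegative, independent among UEs, of
  finite second moment, and with mean `lam` -/
  law_arrival : ∀ t, P.map (A t) = P.map (A 0)
  arrival_nonneg : ∀ t ω i, 0 ≤ A t ω i
  arrival_indep : ∀ t, iIndepFun (fun i ω => A t ω i) P
  arrival_memLp : ∀ t i, MemLp (fun ω => A t ω i) 2 P
  arrival_mean : ∀ t i, ∫ ω, A t ω i ∂P = lam i
  /-- the decisions of slot `t` depend on the past, on randomization, and on the channel state of
  slot `t` -/
  meas_active : ∀ t k,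
    MeasurableSet[𝓖 t ⊔ MeasurableSpace.comap (H t) inferInstance] {ω | k ∈ a t ω}
  meas_beam : ∀ t, Measurable[𝓖 t ⊔ MeasurableSpace.comap (H t) inferInstance] (w t)
  feasible : ∀ t ω, S.Feasible (a t ω) (w t ω)
  /-- initial queues -/
  queue_zero_meas : Measurable[𝓖 0] (Q 0)
  queue_zero_nonneg : ∀ ω i, 0 ≤ Q 0 ω i
  queue_zero_memLp : ∀ i, MemLp (fun ω => Q 0 ω i) 2 P
  /-- queue dynamics -/
  queue_succ : ∀ t ω i,
    Q (t + 1) ω i = max (Q t ω i - S.service (H t ω) (w t ω) i) 0 + A t ω i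

/-- All queues are strongly stable: the time averages of `E[Q_i(t)]` have a finite upper limit
(expectations and limits are taken in `[0, ∞]`; the queues are nonnegative). -/
def StronglyStable {Ω : Type*} {mΩ : MeasurableSpace Ω} (P : Measure Ω)
    (Q : ℕ → Ω → Fin I → ℝ) : Prop :=
  ∀ i, limsup (fun T : ℕ =>
    (∑ t ∈ Finset.range T, ∫⁻ ω, ENNReal.ofReal (Q t ω i) ∂P) / (T : ℝ≥0∞)) atTop < ⊤

/-- `lam` can be stabilized: some arrivals with rate vector `lam` and some feasible
non-anticipating control policy give strongly stable queues. -/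
def Stabilizable (S : CRAN K) (ν : Measure (ChannelState K I M N)) (lam : Fin I → ℝ) : Prop :=
  ∃ (Ω : Type) (mΩ : MeasurableSpace Ω) (P : Measure Ω) (_ : IsProbabilityMeasure P)
    (𝓖 : Filtration ℕ mΩ) (H : ℕ → Ω → ChannelState K I M N) (A Q : ℕ → Ω → Fin I → ℝ)
    (a : ℕ → Ω → Finset (Fin K)) (w : ℕ → Ω → Beamformer K I M),
    S.IsControlled ν lam P 𝓖 H A Q a w ∧ StronglyStable P Q

/-- The (maximum) stability region: the closure of the set of all arrival rate vectors that can be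
stabilized. -/
def stabilityRegion (S : CRAN K) (ν : Measure (ChannelState K I M N)) : Set (Fin I → ℝ) :=
  closure {lam | S.Stabilizable ν lam}

/-- The C-RAN is controlled by solving the per-slot problem optimally in every slot. -/
structure IsP1Controlled (S : CRAN K) (V : ℝ) (ν : Measure (ChannelState K I M N))
    (lam : Fin I → ℝ) {Ω : Type*} {mΩ : MeasurableSpace Ω} (P : Measure Ω) (𝓖 : Filtration ℕ mΩ)
    (H : ℕ → Ω → ChannelState K I M N) (A Q : ℕ → Ω → Fin I → ℝ)
    (a : ℕ → Ω → Finset (Fin K)) (w : ℕ → Ω → Beamformer K I M) : Prop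
    extends S.IsControlled ν lam P 𝓖 H A Q a w where
  optimal : ∀ t ω, S.SolvesP1 V (Q t ω) (H t ω) (a t ω) (w t ω)

/-- `lam` is stabilized by solving the per-slot problem: the C-RAN can be operated in this way at
rate vector `lam`, and whenever it is, the queues are strongly stable. -/
def StabilizedByP1 (S : CRAN K) (V : ℝ) (ν : Measure (ChannelState K I M N))
    (lam : Fin I → ℝ) : Prop :=
  (∃ (Ω : Type) (mΩ : MeasurableSpace Ω) (P : Measure Ω) (_ : IsProbabilityMeasure P)
    (𝓖 : Filtration ℕ mΩ) (H : ℕ → Ω → ChannelState K I M N) (A Q : ℕ → Ω → Fin I → ℝ)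
    (a : ℕ → Ω → Finset (Fin K)) (w : ℕ → Ω → Beamformer K I M),
    S.IsP1Controlled V ν lam P 𝓖 H A Q a w) ∧
  ∀ (Ω : Type) (mΩ : MeasurableSpace Ω) (P : Measure Ω) (_ : IsProbabilityMeasure P)
    (𝓖 : Filtration ℕ mΩ) (H : ℕ → Ω → ChannelState K I M N) (A Q : ℕ → Ω → Fin I → ℝ)
    (a : ℕ → Ω → Finset (Fin K)) (w : ℕ → Ω → Beamformer K I M),
    S.IsP1Controlled V ν lam P 𝓖 H A Q a w → StronglyStable P Q

end CRAN

/-! This is a max-weight argument with a quadratic Lyapunov function. For weights `q ≥ 0` let `M(q)`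
be the expected largest weighted service, the integral of `S.maxWeight q` against `ν`.

Necessity: a decision never serves more than the pointwise maximum, so under any policy the mean of
`∑ q i * Q i` grows by at least `∑ q i * lam i - M(q)` per slot. Strong stability thus forces `∑ q i
* lam i ≤ M(q)` (`Stabilizable.le_lintegral_maxWeight`). Only this inequality is taken from the
stabilizing policy; no stationary randomized policy has to be built.

Sufficiency: network power lies in `[0, maxPower]`, so a solution of the per-slot problem misses the
maximum weight by at most `V * maxPower`. As `Q t` is independent of `H t`, the inequality for a
stabilizable `lam'` applies with `q = Q t ω`, and the mean served weight is at least `∑ lam' i * E[Q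
i]` up to a constant. The drift of the mean squared queues is then at most a constant minus `∑ (lam'
i - lam i) * E[Q i]`; telescoping bounds the time averages (`IsP1Controlled.exists_drift_bound`,
`IsP1Controlled.stronglyStable`).

For the closures, a stabilizable `lam` is approximated by `r • lam` with `r < 1`. That the control
can be operated at all rests on a measurable choice of maximizers (`exists_measurable_isMaxOn`). -/

namespace CRAN

open scoped ComplexOrder

/-! ### Regularity and bounds for service, power and maximum weight -/

section Service

variable {K I M N : ℕ}

theorem signalCov_eq_vecMulVec (h : ChannelState K I M N) (w : Beamformer K I M) (i j : Fin I) :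
    signalCov h w i j
      = Matrix.vecMulVec (Matrix.of (h i) *ᵥ w j) (star (Matrix.of (h i) *ᵥ w j)) := by
  rw [signalCov, Matrix.mul_vecMulVec, Matrix.vecMulVec_mul, Matrix.star_mulVec]

theorem posDef_noiseCov (S : CRAN K) (h : ChannelState K I M N) (w : Beamformer K I M)
    (i : Fin I) : (S.noiseCov h w i).PosDef := by
  refine Matrix.PosDef.posSemidef_add (Matrix.posSemidef_sum _ fun j _ => ?_) ?_
  · rw [signalCov_eq_vecMulVec]
    exact Matrix.posSemidef_vecMulVec_self_star _
  · refine Matrix.PosDef.one.smul ?_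
    have := S.σ_pos
    exact_mod_cast (by positivity : (0 : ℝ) < S.σ ^ 2)

/-- The signal covariance has the form `u uᴴ`, so the matrix determinant lemma turns the determinant
into `1 + uᴴ C⁻¹ u` with `C⁻¹` positive semidefinite. -/
theorem one_le_det_re (S : CRAN K) (h : ChannelState K I M N) (w : Beamformer K I M)
    (i : Fin I) : 1 ≤ (1 + signalCov h w i i * (S.noiseCov h w i)⁻¹).det.re := by
  set u := Matrix.of (h i) *ᵥ w i with hu
  have hC : ((S.noiseCov h w i)⁻¹).PosSemidef := (S.posDef_noiseCov h w i).inv.posSemidef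
  have key : (1 + signalCov h w i i * (S.noiseCov h w i)⁻¹).det
      = 1 + star u ⬝ᵥ ((S.noiseCov h w i)⁻¹ *ᵥ u) := by
    rw [signalCov_eq_vecMulVec, ← hu, Matrix.vecMulVec_mul, Matrix.vecMulVec_eq Unit,
      Matrix.det_one_add_replicateCol_mul_replicateRow, ← Matrix.dotProduct_mulVec]
  have h0 := hC.dotProduct_mulVec_nonneg u
  rw [key, Complex.add_re, Complex.one_re]
  linarith [(Complex.le_def.1 h0).1, Complex.zero_re]

theorem service_nonneg (S : CRAN K) (h : ChannelState K I M N) (w : Beamformer K I M)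
    (i : Fin I) : 0 ≤ S.service h w i :=
  mul_nonneg (mul_pos S.W_pos S.τ_pos).le
    (Real.logb_nonneg one_lt_two (S.one_le_det_re h w i))

/-- Positive noise keeps the determinant of the noise covariance away from zero, so inversion is
continuous, and the argument of the logarithm stays at least `1`. -/
theorem continuous_service (S : CRAN K) (i : Fin I) :
    Continuous fun p : ChannelState K I M N × Beamformer K I M => S.service p.1 p.2 i := by
  have hsig : ∀ j, Continuous
      fun p : ChannelState K I M N × Beamformer K I M => signalCov p.1 p.2 i j := by
    intro j
    have hH : Continuous fun p : ChannelState K I M N × Beamformer K I M =>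
        (Matrix.of (p.1 i) : Matrix (Fin N) (Fin K × Fin M) ℂ) :=
      (continuous_apply i).comp continuous_fst
    have hw : Continuous fun p : ChannelState K I M N × Beamformer K I M => p.2 j :=
      (continuous_apply j).comp continuous_snd
    exact (hH.matrix_mul (hw.matrix_vecMulVec hw.star)).matrix_mul hH.matrix_conjTranspose
  have hnoise : Continuous
      fun p : ChannelState K I M N × Beamformer K I M => S.noiseCov p.1 p.2 i :=
    (continuous_finsetSum _ fun j _ => hsig j).add continuous_const
  have hinv : Continuous
      fun p : ChannelState K I M N × Beamformer K I M => (S.noiseCov p.1 p.2 i)⁻¹ := by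
    simp only [Matrix.inv_def, Ring.inverse_eq_inv']
    exact (hnoise.matrix_det.inv₀ fun p => (S.posDef_noiseCov p.1 p.2 i).det_pos.ne').smul
      hnoise.matrix_adjugate
  have hsum : Continuous fun p : ChannelState K I M N × Beamformer K I M =>
      1 + signalCov p.1 p.2 i i * (S.noiseCov p.1 p.2 i)⁻¹ :=
    continuous_const.add ((hsig i).matrix_mul hinv)
  have hdet : Continuous fun p : ChannelState K I M N × Beamformer K I M =>
      (1 + signalCov p.1 p.2 i i * (S.noiseCov p.1 p.2 i)⁻¹).det.re :=
    Complex.continuous_re.comp hsum.matrix_det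
  refine continuous_const.mul (hdet.logb fun p => ?_)
  exact (zero_lt_one.trans_le (S.one_le_det_re p.1 p.2 i)).ne'

theorem continuous_service_comp (S : CRAN K) (i : Fin I) {X : Type*} [TopologicalSpace X]
    {f : X → ChannelState K I M N} {g : X → Beamformer K I M} (hf : Continuous f)
    (hg : Continuous g) : Continuous fun x => S.service (f x) (g x) i := by
  have hfg := hf.prodMk hg
  have h := (S.continuous_service (M := M) (N := N) i).comp hfg
  exact h

theorem rrhPower_nonneg (w : Beamformer K I M) (k : Fin K) : 0 ≤ rrhPower w k := by
  unfold rrhPower; positivity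

theorem networkPower_nonneg (S : CRAN K) (a : Finset (Fin K)) (w : Beamformer K I M) :
    0 ≤ S.networkPower a w :=
  Finset.sum_nonneg fun k _ => add_nonneg
    (mul_nonneg (one_div_pos.2 (S.η_pos k)).le (rrhPower_nonneg w k)) (S.Pc_nonneg k)

/-- The power drawn by the network when all RRHs are active at full transmit power. -/
noncomputable def maxPower (S : CRAN K) : ℝ :=
  ∑ k, (1 / S.η k * S.Pmax k + S.Pc k)

theorem Feasible.networkPower_le {S : CRAN K} {a : Finset (Fin K)} {w : Beamformer K I M}
    (h : S.Feasible a w) : S.networkPower a w ≤ S.maxPower := by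
  have hk : ∀ k, 1 / S.η k * rrhPower w k + S.Pc k ≤ 1 / S.η k * S.Pmax k + S.Pc k := fun k => by
    have := (one_div_pos.2 (S.η_pos k)).le
    gcongr
    exact h.1 k
  refine (Finset.sum_le_sum fun k _ => hk k).trans
    (Finset.sum_le_sum_of_subset_of_nonneg (Finset.subset_univ a) fun k _ _ => ?_)
  exact add_nonneg (mul_nonneg (one_div_pos.2 (S.η_pos k)).le (S.Pmax_nonneg k)) (S.Pc_nonneg k)

/-- The largest queue-weighted total service in one slot, over all feasible decisions. -/
noncomputable def maxWeight (S : CRAN K) (q : Fin I → ℝ) (h : ChannelState K I M N) : ℝ≥0∞ :=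
  ⨆ (a : Finset (Fin K)) (w : Beamformer K I M) (_ : S.Feasible a w),
    ENNReal.ofReal (∑ i, q i * S.service h w i)

/-- The supremum runs over an uncountable family, so measurability goes through lower
semicontinuity, which survives arbitrary suprema. -/
theorem measurable_iSup_feasible (S : CRAN K) {X : Type*} [TopologicalSpace X]
    [MeasurableSpace X] [OpensMeasurableSpace X] (f : X → Beamformer K I M → ℝ≥0∞)
    (hf : ∀ w, Continuous fun x => f x w) :
    Measurable fun x => ⨆ (a : Finset (Fin K)) (w : Beamformer K I M) (_ : S.Feasible a w),
      f x w := by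
  have : LowerSemicontinuous fun x =>
      ⨆ (a : Finset (Fin K)) (w : Beamformer K I M) (_ : S.Feasible a w), f x w :=
    lowerSemicontinuous_iSup fun a => lowerSemicontinuous_iSup fun w =>
      lowerSemicontinuous_iSup fun _ => (hf w).lowerSemicontinuous
  exact this.measurable

theorem measurable_maxWeight (S : CRAN K) :
    Measurable fun p : (Fin I → ℝ) × ChannelState K I M N => S.maxWeight p.1 p.2 := by
  have hc : ∀ w : Beamformer K I M, Continuous fun p : (Fin I → ℝ) × ChannelState K I M N =>
      ENNReal.ofReal (∑ i, p.1 i * S.service p.2 w i) := fun w => by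
    have h1 : ∀ i, Continuous fun p : (Fin I → ℝ) × ChannelState K I M N => p.1 i := by fun_prop
    have h2 : ∀ i, Continuous fun p : (Fin I → ℝ) × ChannelState K I M N => S.service p.2 w i :=
      fun i => S.continuous_service_comp i continuous_snd continuous_const
    have h3 := continuous_finsetSum Finset.univ fun i _ => (h1 i).mul (h2 i)
    exact ENNReal.continuous_ofReal.comp h3
  have h := measurable_iSup_feasible S
    (fun (p : (Fin I → ℝ) × ChannelState K I M N) (w : Beamformer K I M) =>
      ENNReal.ofReal (∑ i, p.1 i * S.service p.2 w i)) hc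
  exact h

theorem le_maxWeight {S : CRAN K} {a : Finset (Fin K)} {w : Beamformer K I M}
    (hf : S.Feasible a w) (q : Fin I → ℝ) (h : ChannelState K I M N) :
    ENNReal.ofReal (∑ i, q i * S.service h w i) ≤ S.maxWeight q h :=
  le_iSup_of_le a (le_iSup_of_le w (le_iSup_of_le hf le_rfl))

/-- The penalty lies between `0` and `V * maxPower` for every feasible choice, so it can distort the
maximization of the weight by no more than that. -/
theorem SolvesP1.maxWeight_le {S : CRAN K} {V : ℝ} (hV : 0 ≤ V) {q : Fin I → ℝ}
    {h : ChannelState K I M N} {a : Finset (Fin K)} {w : Beamformer K I M}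
    (hs : S.SolvesP1 V q h a w) :
    S.maxWeight q h
      ≤ ENNReal.ofReal (∑ i, q i * S.service h w i) + ENNReal.ofReal (V * S.maxPower) := by
  refine iSup_le fun a' => iSup_le fun w' => iSup_le fun hf => ?_
  refine le_trans (ENNReal.ofReal_le_ofReal ?_) ENNReal.ofReal_add_le
  have h1 := hs.2 a' w' hf
  have h2 := mul_le_mul_of_nonneg_left hf.networkPower_le hV
  have h3 := mul_nonneg hV (S.networkPower_nonneg a w)
  simp only [objective] at h1
  linarith

/-- The square of the largest feasible service of UE `i`. -/
noncomputable def maxServiceSq (S : CRAN K) (i : Fin I) (h : ChannelState K I M N) : ℝ≥0∞ :=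
  ⨆ (a : Finset (Fin K)) (w : Beamformer K I M) (_ : S.Feasible a w),
    ENNReal.ofReal (S.service h w i ^ 2)

theorem measurable_maxServiceSq (S : CRAN K) (i : Fin I) :
    Measurable (S.maxServiceSq i : ChannelState K I M N → ℝ≥0∞) := by
  have hc : ∀ w : Beamformer K I M, Continuous fun h : ChannelState K I M N =>
      ENNReal.ofReal (S.service h w i ^ 2) := fun w => by
    have h2 : Continuous fun h : ChannelState K I M N => S.service h w i :=
      S.continuous_service_comp i continuous_id continuous_const
    have h3 := h2.pow 2
    exact ENNReal.continuous_ofReal.comp h3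
  have h := measurable_iSup_feasible S (fun (h : ChannelState K I M N)
    (w : Beamformer K I M) => ENNReal.ofReal (S.service h w i ^ 2)) hc
  exact h

theorem le_maxServiceSq {S : CRAN K} {a : Finset (Fin K)} {w : Beamformer K I M}
    (hf : S.Feasible a w) (i : Fin I) (h : ChannelState K I M N) :
    ENNReal.ofReal (S.service h w i ^ 2) ≤ S.maxServiceSq i h :=
  le_iSup_of_le a (le_iSup_of_le w (le_iSup_of_le hf le_rfl))

end Service

/-! ### Measurable selection of maximizers -/

/-- A jointly continuous function has a measurable selection of maximizers over a compact set. -/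
theorem exists_measurable_isMaxOn {X Y : Type*} [TopologicalSpace X] [MeasurableSpace X]
    [OpensMeasurableSpace X] [TopologicalSpace Y] [TopologicalSpace.MetrizableSpace Y]
    [MeasurableSpace Y] [BorelSpace Y] {F : Set Y}
    (hF : IsCompact F) (hne : F.Nonempty) {f : X → Y → ℝ} (hf : Continuous (Function.uncurry f)) :
    ∃ s : X → Y, Measurable s ∧ ∀ x, s x ∈ F ∧ IsMaxOn (f x) F (s x) := by
  let _ := TopologicalSpace.metrizableSpaceMetric Y
  have : CompactSpace F := isCompact_iff_compactSpace.1 hF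
  have : Nonempty F := hne.to_subtype
  -- `F` is parametrized by the Cantor set, whose order as a subset of `ℝ` gives a canonical choice:
  -- the least parameter of a maximizer.
  obtain ⟨ψ, hψ, hψs⟩ := exists_nat_bool_continuous_surjective_of_compact F
  set φ : cantorSet → F := ψ ∘ cantorSetHomeomorphNatToBool with hφ
  have hφc : Continuous φ := hψ.comp cantorSetHomeomorphNatToBool.continuous
  have hφs : Function.Surjective φ := hψs.comp cantorSetHomeomorphNatToBool.surjective
  have : CompactSpace cantorSet := isCompact_iff_compactSpace.1 isCompact_cantorSet
  have : Nonempty cantorSet := (hφs (Classical.arbitrary F)).nonempty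
  set g : X → cantorSet → ℝ := fun x t => f x (φ t) with hg
  have hgc : Continuous (Function.uncurry g) :=
    hf.comp (continuous_fst.prodMk
      (continuous_subtype_val.comp (hφc.comp continuous_snd)))
  have hgx : ∀ x, Continuous (g x) := fun x => hgc.comp (Continuous.prodMk_right x)
  have hleast : ∀ x, ∃ t, IsLeast {t | ∀ s, g x s ≤ g x t} t := by
    intro x
    refine IsCompact.exists_isLeast (IsClosed.isCompact ?_) ?_
    · rw [Set.ofPred_forall]
      exact isClosed_iInter fun s => isClosed_le continuous_const (hgx x)
    · obtain ⟨t, -, ht⟩ := isCompact_univ.exists_isMaxOn Set.univ_nonempty (hgx x).continuousOn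
      exact ⟨t, fun s => ht (Set.mem_univ s)⟩
  choose T hT using hleast
  have hTm : Measurable T := by
    suffices h : Measurable fun x => (T x : ℝ) from h.subtype_mk (h := fun x => (T x).2)
    refine measurable_of_Iic fun c => IsClosed.measurableSet ?_
    -- `T x ≤ c` iff every `s` is matched or beaten by some parameter `t ≤ c`; taking `s = T x`
    -- makes that `t` a maximizer. Each set in the intersection is a projection of a closed set
    -- along a compact factor, hence closed.
    have hset : (fun x => (T x : ℝ)) ⁻¹' Set.Iic c
        = ⋂ s, Prod.fst '' {p : X × cantorSet | (p.2 : ℝ) ≤ c ∧ g p.1 s ≤ g p.1 p.2} := by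
      ext x
      simp only [Set.mem_preimage, Set.mem_Iic, Set.mem_iInter, Set.mem_image, Set.mem_ofPred_eq,
        Prod.exists, exists_and_right, exists_eq_right]
      constructor
      · exact fun h s => ⟨T x, h, (hT x).1 s⟩
      · intro h
        obtain ⟨t, htc, ht⟩ := h (T x)
        exact (Subtype.coe_le_coe.2 ((hT x).2 fun s => ((hT x).1 s).trans ht)).trans htc
    rw [hset]
    refine isClosed_iInter fun s => isClosedMap_fst_of_compactSpace _ ?_
    exact (isClosed_le (continuous_subtype_val.comp continuous_snd) continuous_const).inter
      (isClosed_le (hgc.comp (continuous_fst.prodMk continuous_const)) hgc)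
  refine ⟨fun x => φ (T x), ?_, fun x => ⟨(φ (T x)).2, fun y hy => ?_⟩⟩
  · exact (continuous_subtype_val.comp hφc).measurable.comp hTm
  · obtain ⟨t, ht⟩ := hφs ⟨y, hy⟩
    have := (hT x).1 t
    simp only [hg, ht] at this
    exact this

section Selection

variable {K I M N : ℕ}

/-- The set of active RRHs with a given indicator function. -/
def activeSet (b : Fin K → Bool) : Finset (Fin K) :=
  Finset.univ.filter fun k => b k = true

theorem mem_activeSet {b : Fin K → Bool} {k : Fin K} : k ∈ activeSet b ↔ b k = true := by
  simp [activeSet]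

theorem activeSet_decide (a : Finset (Fin K)) : activeSet (fun k => decide (k ∈ a)) = a := by
  ext k; simp [mem_activeSet]

theorem continuous_rrhPower (k : Fin K) :
    Continuous fun w : Beamformer K I M => rrhPower w k := by
  unfold rrhPower; fun_prop

/-- The set of feasible decisions, active sets being coded by their indicator functions. -/
def feasibleSet (S : CRAN K) (I M : ℕ) : Set ((Fin K → Bool) × Beamformer K I M) :=
  {p | S.Feasible (activeSet p.1) p.2}

/-- The indicators form a finite discrete space, and the power budget bounds each beamformer entry
by `√(S.Pmax k)`. -/
theorem isCompact_feasibleSet (S : CRAN K) : IsCompact (S.feasibleSet I M) := by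
  have hcl : IsClosed (S.feasibleSet I M) := by
    have hs : S.feasibleSet I M
        = (⋂ k, {p | rrhPower p.2 k ≤ S.Pmax k}) ∩
          ⋂ k, ⋂ i, ⋂ m, ({p | p.1 k = true} ∪ {p | p.2 i (k, m) = 0}) := by
      ext p
      simp only [feasibleSet, Feasible, mem_activeSet, Set.mem_ofPred_eq, Set.mem_inter_iff,
        Set.mem_iInter, Set.mem_union]
      refine and_congr_right fun _ => forall_congr' fun k => ?_
      by_cases hk : p.1 k = true <;> simp [hk]
    rw [hs]
    refine (isClosed_iInter fun k => isClosed_le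
      ((continuous_rrhPower k).comp continuous_snd) continuous_const).inter
      (isClosed_iInter fun k => isClosed_iInter fun i => isClosed_iInter fun m => ?_)
    exact (isClosed_eq (by fun_prop) continuous_const).union
      (isClosed_eq (by fun_prop) continuous_const)
  refine IsCompact.of_isClosed_subset (isCompact_univ.prod
    (isCompact_univ_pi fun _ : Fin I => isCompact_univ_pi fun km : Fin K × Fin M =>
      isCompact_closedBall (0 : ℂ) (√(S.Pmax km.1)))) hcl ?_
  rintro p hp
  refine ⟨Set.mem_univ _, fun i _ km _ => ?_⟩
  rw [mem_closedBall_zero_iff]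
  refine Real.le_sqrt_of_sq_le (le_trans ?_ (hp.1 km.1))
  unfold rrhPower
  refine le_trans ?_ (Finset.single_le_sum
    (f := fun i => ∑ m, ‖p.2 i (km.1, m)‖ ^ 2) (fun i _ => by positivity) (Finset.mem_univ i))
  exact Finset.single_le_sum
    (f := fun m => ‖p.2 i (km.1, m)‖ ^ 2) (fun i _ => by positivity) (Finset.mem_univ km.2)

theorem feasibleSet_nonempty (S : CRAN K) : (S.feasibleSet I M).Nonempty :=
  ⟨(fun _ => false, 0), fun k => by simpa [rrhPower] using S.Pmax_nonneg k,
    fun k _ i m => rfl⟩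

theorem continuous_networkPower (S : CRAN K) :
    Continuous fun p : (Fin K → Bool) × Beamformer K I M =>
      S.networkPower (activeSet p.1) p.2 := by
  refine continuous_prod_of_discrete_left.2 fun b => ?_
  have h : ∀ k, Continuous fun w : Beamformer K I M => 1 / S.η k * rrhPower w k + S.Pc k :=
    fun k => (continuous_const.mul (continuous_rrhPower k)).add continuous_const
  exact continuous_finsetSum (activeSet b) fun k _ => h k

theorem continuous_objective (S : CRAN K) (V : ℝ) : Continuous (Function.uncurry
    fun (x : (Fin I → ℝ) × ChannelState K I M N) (y : (Fin K → Bool) × Beamformer K I M) =>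
      S.objective V x.1 x.2 (activeSet y.1) y.2) := by
  have h1 : ∀ i, Continuous fun p : ((Fin I → ℝ) × ChannelState K I M N) ×
      ((Fin K → Bool) × Beamformer K I M) => p.1.1 i := by fun_prop
  have h2 : ∀ i, Continuous fun p : ((Fin I → ℝ) × ChannelState K I M N) ×
      ((Fin K → Bool) × Beamformer K I M) => S.service p.1.2 p.2.2 i := fun i =>
    S.continuous_service_comp i (continuous_snd.comp continuous_fst)
      (continuous_snd.comp continuous_snd)
  have h3 : Continuous fun p : ((Fin I → ℝ) × ChannelState K I M N) ×
      ((Fin K → Bool) × Beamformer K I M) => S.networkPower (activeSet p.2.1) p.2.2 := by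
    have h := S.continuous_networkPower (I := I) (M := M)
    exact h.comp continuous_snd
  have h4 := (continuous_finsetSum Finset.univ fun i _ => (h1 i).mul (h2 i)).sub
    ((continuous_const (y := V)).mul h3)
  exact h4

/-- Optimal solutions of the per-slot problem can be chosen measurably. -/
theorem exists_measurable_solvesP1 (S : CRAN K) (V : ℝ) :
    ∃ s : (Fin I → ℝ) × ChannelState K I M N → (Fin K → Bool) × Beamformer K I M,
      Measurable s ∧ ∀ q h, S.SolvesP1 V q h (activeSet (s (q, h)).1) (s (q, h)).2 := by
  have hc := S.continuous_objective (I := I) (M := M) (N := N) V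
  obtain ⟨s, hs, hmax⟩ := exists_measurable_isMaxOn (S.isCompact_feasibleSet (I := I) (M := M))
    (S.feasibleSet_nonempty (I := I) (M := M)) hc
  refine ⟨s, hs, fun q h => ⟨(hmax (q, h)).1, fun a' w' hf => ?_⟩⟩
  have := isMaxOn_iff.1 (hmax (q, h)).2 (fun k => decide (k ∈ a'), w') (by
    simpa only [feasibleSet, Set.mem_ofPred_eq, activeSet_decide] using hf)
  simpa only [activeSet_decide] using this

end Selection

/-- Needed because the existence construction uses deterministic arrivals. -/
theorem iIndepFun_const {Ω ι : Type*} {mΩ : MeasurableSpace Ω} (P : Measure Ω)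
    [IsProbabilityMeasure P] {β : ι → Type*} [∀ i, MeasurableSpace (β i)] (c : ∀ i, β i) :
    iIndepFun (fun i (_ : Ω) => c i) P := by
  classical
  rw [iIndepFun_iff_measure_inter_preimage_eq_mul]
  intro s B _
  by_cases h : ∀ i ∈ s, c i ∈ B i
  · have h1 : ∀ i ∈ s, P ((fun _ : Ω => c i) ⁻¹' B i) = 1 := fun i hi => by
      rw [Set.preimage_const_of_mem (h i hi), measure_univ]
    have h2 : (⋂ i ∈ s, (fun _ : Ω => c i) ⁻¹' B i) = Set.univ :=
      Set.eq_univ_of_univ_subset (Set.subset_iInter₂ fun i hi =>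
        (Set.preimage_const_of_mem (h i hi)).superset)
    rw [h2, measure_univ, Finset.prod_congr rfl h1, Finset.prod_const_one]
  · push Not at h
    obtain ⟨i, hi, hB⟩ := h
    have h1 : (fun _ : Ω => c i) ⁻¹' B i = ∅ := Set.preimage_const_of_notMem hB
    have h2 : (⋂ i ∈ s, (fun _ : Ω => c i) ⁻¹' B i) = ∅ :=
      Set.subset_empty_iff.1 ((Set.iInter₂_subset i hi).trans h1.subset)
    rw [h2, measure_empty, Finset.prod_eq_zero hi (by rw [h1, measure_empty])]

/-! ### Operating the network by the per-slot problem -/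

section Existence

variable {K I M N : ℕ}

/-- The filtration of the coordinate process, the coordinate `t` being revealed after time `t`. -/
def pastFiltration (X : Type*) [mX : MeasurableSpace X] :
    Filtration ℕ (inferInstance : MeasurableSpace (ℕ → X)) where
  seq t := ⨆ s ∈ Set.Iio t, MeasurableSpace.comap (fun ω : ℕ → X => ω s) mX
  mono' _ _ h := biSup_mono fun _ hs => lt_of_lt_of_le hs h
  le' _ := iSup₂_le fun s _ => (measurable_pi_apply s).comap_le

theorem measurable_eval_pastFiltration (X : Type*) [mX : MeasurableSpace X] (t : ℕ) :
    Measurable[pastFiltration X (t + 1)] fun ω : ℕ → X => ω t :=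
  Measurable.mono (comap_measurable _)
    (le_iSup₂_of_le (f := fun s (_ : s ∈ Set.Iio (t + 1)) =>
      MeasurableSpace.comap (fun ω : ℕ → X => ω s) mX) t (Nat.lt_succ_self t) le_rfl) le_rfl

theorem indep_eval_pastFiltration {X : Type*} [mX : MeasurableSpace X] (ν : Measure X)
    [IsProbabilityMeasure ν] (t : ℕ) :
    Indep (MeasurableSpace.comap (fun ω : ℕ → X => ω t) mX) (pastFiltration X t)
      (Measure.infinitePi fun _ : ℕ => ν) := by
  have h : iIndepFun (fun (s : ℕ) (ω : ℕ → X) => ω s) (Measure.infinitePi fun _ : ℕ => ν) :=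
    iIndepFun_infinitePi (P := fun _ : ℕ => ν) (X := fun _ x => x) fun _ => measurable_id
  have h2 := indep_iSup_of_disjoint (fun s => (measurable_pi_apply s).comap_le)
    ((iIndepFun_iff_iIndep _ _ _).1 h) (S := {t}) (T := Set.Iio t) (by simp)
  simp only [Set.mem_singleton_iff, iSup_iSup_eq_left] at h2
  exact h2

/-- The queue lengths of the network started empty, with constant arrivals `lam`, when the
decision is a function `s` of the queue lengths and of the channel state. -/
noncomputable def queueEvolution (S : CRAN K) (lam : Fin I → ℝ)
    (s : (Fin I → ℝ) × ChannelState K I M N → (Fin K → Bool) × Beamformer K I M) :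
    ℕ → (ℕ → ChannelState K I M N) → Fin I → ℝ
  | 0, _ => 0
  | t + 1, ω => fun i => max (queueEvolution S lam s t ω i
      - S.service (ω t) (s (queueEvolution S lam s t ω, ω t)).2 i) 0 + lam i

theorem measurable_service_comp (S : CRAN K) (i : Fin I) {Ω : Type*} {mΩ : MeasurableSpace Ω}
    {f : Ω → ChannelState K I M N} {g : Ω → Beamformer K I M} (hf : Measurable f)
    (hg : Measurable g) : Measurable fun ω => S.service (f ω) (g ω) i := by
  have hfg := hf.prodMk hg
  have h := (S.continuous_service (M := M) (N := N) i).measurable.comp hfg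
  exact h

theorem measurable_queue_step (S : CRAN K) (lam : Fin I → ℝ)
    {s : (Fin I → ℝ) × ChannelState K I M N → (Fin K → Bool) × Beamformer K I M}
    (hs : Measurable s) {Ω : Type*} {mΩ : MeasurableSpace Ω} {q : Ω → Fin I → ℝ}
    {h : Ω → ChannelState K I M N} (hq : Measurable q) (hh : Measurable h) :
    Measurable fun ω i => max (q ω i - S.service (h ω) (s (q ω, h ω)).2 i) 0 + lam i := by
  refine measurable_pi_lambda _ fun i => ?_
  have hμ := S.measurable_service_comp i hh (hs.comp (hq.prodMk hh)).snd
  exact ((((measurable_pi_apply i).comp hq).sub hμ).max measurable_const).add_const _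

theorem measurable_queueEvolution (S : CRAN K) (lam : Fin I → ℝ)
    {s : (Fin I → ℝ) × ChannelState K I M N → (Fin K → Bool) × Beamformer K I M}
    (hs : Measurable s) (t : ℕ) :
    Measurable[pastFiltration (ChannelState K I M N) t] (S.queueEvolution lam s t) := by
  induction t with
  | zero => exact measurable_const
  | succ t ih =>
    have hH := measurable_eval_pastFiltration (ChannelState K I M N) t
    have hQ := ih.mono ((pastFiltration (ChannelState K I M N)).mono t.le_succ) le_rfl
    exact S.measurable_queue_step lam hs hQ hH

/-- The network can be operated by solving the per-slot problem in every slot, at every rate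
vector. -/
theorem exists_isP1Controlled (S : CRAN K) (V : ℝ) (ν : Measure (ChannelState K I M N))
    [IsProbabilityMeasure ν] {lam : Fin I → ℝ} (hlam : ∀ i, 0 ≤ lam i) :
    ∃ (Ω : Type) (mΩ : MeasurableSpace Ω) (P : Measure Ω) (_ : IsProbabilityMeasure P)
    (𝓖 : Filtration ℕ mΩ) (H : ℕ → Ω → ChannelState K I M N) (A Q : ℕ → Ω → Fin I → ℝ)
    (a : ℕ → Ω → Finset (Fin K)) (w : ℕ → Ω → Beamformer K I M),
    S.IsP1Controlled V ν lam P 𝓖 H A Q a w := by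
  obtain ⟨s, hs, hopt⟩ := S.exists_measurable_solvesP1 (I := I) (M := M) (N := N) V
  have hQ := S.measurable_queueEvolution lam hs
  have hdec : ∀ t, Measurable[pastFiltration (ChannelState K I M N) t ⊔
      MeasurableSpace.comap (fun ω : ℕ → ChannelState K I M N => ω t) inferInstance]
      fun ω => s (S.queueEvolution lam s t ω, ω t) := fun t =>
    hs.comp (((hQ t).mono le_sup_left le_rfl).prodMk
      ((comap_measurable _).mono le_sup_right le_rfl))
  -- Channels are the coordinates of an infinite product; constant arrivals and empty initial queues
  -- suffice, since one realization at the given rates is enough.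
  refine ⟨ℕ → ChannelState K I M N, inferInstance, Measure.infinitePi fun _ => ν, inferInstance,
    pastFiltration _, fun t ω => ω t, fun _ _ => lam, S.queueEvolution lam s,
    fun t ω => activeSet (s (S.queueEvolution lam s t ω, ω t)).1,
    fun t ω => (s (S.queueEvolution lam s t ω, ω t)).2, ?_⟩
  exact
  { meas_channel := measurable_eval_pastFiltration _
    meas_arrival := fun _ => measurable_const
    indep_past := fun t => by
      refine indep_of_indep_of_le_left (indep_eval_pastFiltration ν t) ?_
      have : Measurable[MeasurableSpace.comap (fun ω : ℕ → ChannelState K I M N => ω t)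
          inferInstance] fun ω : ℕ → ChannelState K I M N => (ω t, lam) :=
        (comap_measurable _).prodMk measurable_const
      exact this.comap_le
    law_channel := fun t => Measure.infinitePi_map_eval (fun _ => ν) t
    law_arrival := fun _ => rfl
    arrival_nonneg := fun _ _ => hlam
    arrival_indep := fun _ => iIndepFun_const _ lam
    arrival_memLp := fun _ _ => memLp_const _
    arrival_mean := fun _ i => by simp
    meas_active := fun t k => by
      simp only [mem_activeSet]
      exact ((measurable_pi_apply k).comp (hdec t).fst) (measurableSet_singleton true)
    meas_beam := fun t => (hdec t).snd
    feasible := fun t ω => (hopt _ _).1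
    queue_zero_meas := measurable_const
    queue_zero_nonneg := fun _ _ => le_rfl
    queue_zero_memLp := fun _ => memLp_const _
    queue_succ := fun _ _ _ => rfl
    optimal := fun t ω => hopt _ _ }

end Existence

/-! ### Finite upper time averages as linear bounds on partial sums -/

theorem limsup_average_lt_top_iff {x : ℕ → ℝ≥0∞} :
    limsup (fun T : ℕ => (∑ t ∈ Finset.range T, x t) / (T : ℝ≥0∞)) atTop < ⊤ ↔
      ∃ C : ℝ≥0∞, C ≠ ⊤ ∧ ∀ᶠ T : ℕ in atTop, ∑ t ∈ Finset.range T, x t ≤ C * T := by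
  constructor
  · intro h
    obtain ⟨C, hC, hC'⟩ := exists_between h
    refine ⟨C, hC'.ne, ?_⟩
    filter_upwards [eventually_lt_of_limsup_lt hC, eventually_gt_atTop 0] with T hT hpos
    exact (ENNReal.div_le_iff (by exact_mod_cast hpos.ne') (ENNReal.natCast_ne_top T)).1 hT.le
  · rintro ⟨C, hC, h⟩
    refine lt_of_le_of_lt (limsup_le_of_le ?_ ?_) hC.lt_top
    · isBoundedDefault
    · filter_upwards [h] with T hT
      exact ENNReal.div_le_of_le_mul hT

theorem limsup_average_const_mul_sum_lt_top {ι : Type*} (s : Finset ι) {c : ι → ℝ≥0∞}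
    (hc : ∀ i ∈ s, c i ≠ ⊤) {x : ι → ℕ → ℝ≥0∞}
    (hx : ∀ i ∈ s,
      limsup (fun T : ℕ => (∑ t ∈ Finset.range T, x i t) / (T : ℝ≥0∞)) atTop < ⊤) :
    limsup (fun T : ℕ => (∑ t ∈ Finset.range T, ∑ i ∈ s, c i * x i t) / (T : ℝ≥0∞)) atTop
      < ⊤ := by
  simp only [limsup_average_lt_top_iff] at hx ⊢
  choose! C hC hCx using hx
  refine ⟨∑ i ∈ s, c i * C i,
    ENNReal.sum_ne_top.2 fun i hi => ENNReal.mul_ne_top (hc i hi) (hC i hi), ?_⟩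
  filter_upwards [(Finset.eventually_all s).2 hCx] with T hT
  rw [Finset.sum_comm, Finset.sum_mul]
  refine Finset.sum_le_sum fun i hi => ?_
  rw [← Finset.mul_sum, mul_assoc]
  gcongr
  exact hT i hi

theorem limsup_average_eq_top_of_linear_growth {x : ℕ → ℝ≥0∞} {c : ℝ≥0∞} (hc : c ≠ 0)
    (hx : ∀ t : ℕ, t * c ≤ x t) :
    ¬ limsup (fun T : ℕ => (∑ t ∈ Finset.range T, x t) / (T : ℝ≥0∞)) atTop < ⊤ := by
  rw [limsup_average_lt_top_iff]
  rintro ⟨C, hC, h⟩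
  obtain ⟨T₀, hT₀⟩ := eventually_atTop.1 h
  obtain ⟨n, hn⟩ := ENNReal.exists_nat_mul_gt hc hC
  set m := max n T₀
  have h1 : C < m * c := hn.trans_le (by gcongr; exact le_max_left _ _)
  -- Over the odd length `2 * m + 1` the average of `t` is exactly `m`, so the average of `x` is at
  -- least `m * c > C`.
  have h2 := hT₀ (2 * m + 1) ((le_max_right n T₀).trans (by omega))
  have h3 : ((2 * m + 1 : ℕ) : ℝ≥0∞) * (m * c) ≤ C * (2 * m + 1 : ℕ) := by
    refine le_trans ?_ ((Finset.sum_le_sum fun t _ => hx t).trans h2)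
    rw [← Finset.sum_mul, ← Nat.cast_sum, ← mul_assoc, ← Nat.cast_mul]
    gcongr
    have := Finset.sum_range_id_mul_two (2 * m + 1)
    simp only [Nat.add_sub_cancel] at this
    nlinarith
  rw [mul_comm C] at h3
  rw [ENNReal.mul_le_mul_iff_right (by positivity) (ENNReal.natCast_ne_top _)] at h3
  exact absurd h3 (not_le.2 h1)

/-! ### Necessary condition for stability under an arbitrary policy -/

theorem measurable_maxWeight_right {K I M N : ℕ} (S : CRAN K) (q : Fin I → ℝ) :
    Measurable fun h : ChannelState K I M N => S.maxWeight q h := by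
  have h := (S.measurable_maxWeight (I := I) (M := M) (N := N)).comp
    (measurable_prodMk_left (x := q))
  exact h

theorem measurable_queue_update {ι Ω : Type*} {mΩ : MeasurableSpace Ω} {q α : Ω → ι → ℝ}
    {μ : ι → Ω → ℝ} (hq : Measurable q) (hμ : ∀ i, Measurable (μ i)) (hα : Measurable α) :
    Measurable fun ω i => max (q ω i - μ i ω) 0 + α ω i :=
  measurable_pi_lambda _ fun i => (((measurable_pi_iff.1 hq i).sub (hμ i)).max
    measurable_const).add (measurable_pi_iff.1 hα i)

namespace IsControlled

variable {K I M N : ℕ} {S : CRAN K} {ν : Measure (ChannelState K I M N)} {lam : Fin I → ℝ}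
  {Ω : Type*} {mΩ : MeasurableSpace Ω} {P : Measure Ω} {𝓖 : Filtration ℕ mΩ}
  {H : ℕ → Ω → ChannelState K I M N} {A Q : ℕ → Ω → Fin I → ℝ}
  {a : ℕ → Ω → Finset (Fin K)} {w : ℕ → Ω → Beamformer K I M}

theorem measurable_channel (hc : S.IsControlled ν lam P 𝓖 H A Q a w) (t : ℕ) :
    Measurable (H t) :=
  (hc.meas_channel t).mono (𝓖.le _) le_rfl

theorem measurable_arrival (hc : S.IsControlled ν lam P 𝓖 H A Q a w) (t : ℕ) (i : Fin I) :
    Measurable fun ω => A t ω i :=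
  (measurable_pi_apply i).comp ((hc.meas_arrival t).mono (𝓖.le _) le_rfl)

theorem measurable_service_filtration (hc : S.IsControlled ν lam P 𝓖 H A Q a w) (t : ℕ)
    (i : Fin I) : Measurable[𝓖 (t + 1)] fun ω => S.service (H t ω) (w t ω) i :=
  S.measurable_service_comp i (hc.meas_channel t) ((hc.meas_beam t).mono
    (sup_le (𝓖.mono t.le_succ) (hc.meas_channel t).comap_le) le_rfl)

theorem measurable_service (hc : S.IsControlled ν lam P 𝓖 H A Q a w) (t : ℕ) (i : Fin I) :
    Measurable fun ω => S.service (H t ω) (w t ω) i :=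
  (hc.measurable_service_filtration t i).mono (𝓖.le _) le_rfl

theorem measurable_queue_filtration (hc : S.IsControlled ν lam P 𝓖 H A Q a w) (t : ℕ) :
    Measurable[𝓖 t] (Q t) := by
  induction t with
  | zero => exact hc.queue_zero_meas
  | succ t ih =>
    have h : Q (t + 1) = fun ω i =>
        max (Q t ω i - S.service (H t ω) (w t ω) i) 0 + A t ω i :=
      funext fun ω => funext fun i => hc.queue_succ t ω i
    rw [h]
    exact measurable_queue_update (ih.mono (𝓖.mono t.le_succ) le_rfl)
      (hc.measurable_service_filtration t) (hc.meas_arrival t)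

theorem measurable_queue (hc : S.IsControlled ν lam P 𝓖 H A Q a w) (t : ℕ) :
    Measurable (Q t) :=
  (hc.measurable_queue_filtration t).mono (𝓖.le _) le_rfl

theorem measurable_queue_apply (hc : S.IsControlled ν lam P 𝓖 H A Q a w) (t : ℕ) (i : Fin I) :
    Measurable fun ω => Q t ω i :=
  (measurable_pi_apply i).comp (hc.measurable_queue t)

theorem queue_nonneg (hc : S.IsControlled ν lam P 𝓖 H A Q a w) (t : ℕ) (ω : Ω) (i : Fin I) :
    0 ≤ Q t ω i := by
  cases t with
  | zero => exact hc.queue_zero_nonneg ω i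
  | succ t =>
    rw [hc.queue_succ]
    exact add_nonneg (le_max_right _ _) (hc.arrival_nonneg t ω i)

theorem rate_nonneg (hc : S.IsControlled ν lam P 𝓖 H A Q a w) (i : Fin I) : 0 ≤ lam i := by
  rw [← hc.arrival_mean 0 i]
  exact integral_nonneg fun ω => hc.arrival_nonneg 0 ω i

theorem lintegral_arrival [IsProbabilityMeasure P] (hc : S.IsControlled ν lam P 𝓖 H A Q a w)
    (t : ℕ) (i : Fin I) : ∫⁻ ω, ENNReal.ofReal (A t ω i) ∂P = ENNReal.ofReal (lam i) := by
  rw [← hc.arrival_mean t i]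
  exact (ofReal_integral_eq_lintegral_ofReal ((hc.arrival_memLp t i).integrable one_le_two)
    (Eventually.of_forall fun ω => hc.arrival_nonneg t ω i)).symm

theorem indepFun_queue_arrival (hc : S.IsControlled ν lam P 𝓖 H A Q a w) (t : ℕ) :
    IndepFun (Q t) (A t) P := by
  rw [IndepFun_iff_Indep]
  refine (indep_of_indep_of_le_left (indep_of_indep_of_le_right (hc.indep_past t)
    (hc.measurable_queue_filtration t).comap_le) ?_).symm
  exact (measurable_snd.comp (comap_measurable fun ω => (H t ω, A t ω))).comap_le

theorem indepFun_queue_channel (hc : S.IsControlled ν lam P 𝓖 H A Q a w) (t : ℕ) :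
    IndepFun (Q t) (H t) P := by
  rw [IndepFun_iff_Indep]
  refine (indep_of_indep_of_le_left (indep_of_indep_of_le_right (hc.indep_past t)
    (hc.measurable_queue_filtration t).comap_le) ?_).symm
  exact (measurable_fst.comp (comap_measurable fun ω => (H t ω, A t ω))).comap_le

/-- The pointwise maximum depends on the channel alone, so only the law of `H t` matters: neither
memory nor randomization can beat it. -/
theorem lintegral_weighted_service_le [IsProbabilityMeasure P]
    (hc : S.IsControlled ν lam P 𝓖 H A Q a w) (q : Fin I → ℝ) (t : ℕ) :
    ∫⁻ ω, ENNReal.ofReal (∑ i, q i * S.service (H t ω) (w t ω) i) ∂P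
      ≤ ∫⁻ h, S.maxWeight q h ∂ν := by
  rw [← hc.law_channel t, lintegral_map (S.measurable_maxWeight_right q) (hc.measurable_channel t)]
  exact lintegral_mono fun ω => le_maxWeight (hc.feasible t ω) q _

/-- Under any policy the weighted queue lengths grow at least like the excess of the weighted
arrival rates over the largest weighted service rate. -/
theorem weighted_queue_growth [IsProbabilityMeasure P]
    (hc : S.IsControlled ν lam P 𝓖 H A Q a w) {q : Fin I → ℝ} (hq : ∀ i, 0 ≤ q i) (t : ℕ) :
    t * ENNReal.ofReal (∑ i, q i * lam i)
      ≤ ∑ i, ENNReal.ofReal (q i) * ∫⁻ ω, ENNReal.ofReal (Q t ω i) ∂P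
        + t * ∫⁻ h, S.maxWeight q h ∂ν := by
  have hX : ∀ t, ∫⁻ ω, ENNReal.ofReal (∑ i, q i * Q t ω i) ∂P
      = ∑ i, ENNReal.ofReal (q i) * ∫⁻ ω, ENNReal.ofReal (Q t ω i) ∂P := fun t => by
    simp_rw [ENNReal.ofReal_sum_of_nonneg fun i _ => mul_nonneg (hq i) (hc.queue_nonneg t _ i),
      fun i => ENNReal.ofReal_mul (hq i)]
    rw [lintegral_finsetSum _ fun i _ =>
      (hc.measurable_queue_apply t i).ennreal_ofReal.const_mul _]
    exact Finset.sum_congr rfl fun i _ =>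
      lintegral_const_mul _ (hc.measurable_queue_apply t i).ennreal_ofReal
  have hA : ∀ t, ∫⁻ ω, ENNReal.ofReal (∑ i, q i * A t ω i) ∂P
      = ENNReal.ofReal (∑ i, q i * lam i) := fun t => by
    simp_rw [ENNReal.ofReal_sum_of_nonneg fun i _ => mul_nonneg (hq i) (hc.arrival_nonneg t _ i),
      ENNReal.ofReal_sum_of_nonneg fun i _ => mul_nonneg (hq i) (hc.rate_nonneg i),
      fun i => ENNReal.ofReal_mul (hq i)]
    rw [lintegral_finsetSum _ fun i _ => (hc.measurable_arrival t i).ennreal_ofReal.const_mul _]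
    exact Finset.sum_congr rfl fun i _ => by
      rw [lintegral_const_mul _ (hc.measurable_arrival t i).ennreal_ofReal, hc.lintegral_arrival]
  simp only [← hX]
  induction t with
  | zero => simp
  | succ t ih =>
    -- Pointwise `Q t + A t ≤ Q (t + 1) + μ`, because the positive part only increases the queue.
    -- Written additively, it needs no finiteness.
    have hstep : ∫⁻ ω, ENNReal.ofReal (∑ i, q i * Q t ω i) ∂P
        + ENNReal.ofReal (∑ i, q i * lam i)
        ≤ ∫⁻ ω, ENNReal.ofReal (∑ i, q i * Q (t + 1) ω i) ∂P + ∫⁻ h, S.maxWeight q h ∂ν := by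
      have hQm : ∀ t, Measurable fun ω => ENNReal.ofReal (∑ i, q i * Q t ω i) := fun t =>
        (Finset.measurable_sum _ fun i _ =>
          (hc.measurable_queue_apply t i).const_mul _).ennreal_ofReal
      rw [← hA t, ← lintegral_add_left (hQm t)]
      refine le_trans ?_ (add_le_add_right (hc.lintegral_weighted_service_le q t) _)
      rw [← lintegral_add_left (hQm (t + 1))]
      refine lintegral_mono fun ω => ?_
      rw [← ENNReal.ofReal_add
          (Finset.sum_nonneg fun i _ => mul_nonneg (hq i) (hc.queue_nonneg t ω i))
          (Finset.sum_nonneg fun i _ => mul_nonneg (hq i) (hc.arrival_nonneg t ω i)),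
        ← ENNReal.ofReal_add
          (Finset.sum_nonneg fun i _ => mul_nonneg (hq i) (hc.queue_nonneg (t + 1) ω i))
          (Finset.sum_nonneg fun i _ => mul_nonneg (hq i) (S.service_nonneg _ _ i)),
        ← Finset.sum_add_distrib, ← Finset.sum_add_distrib]
      refine ENNReal.ofReal_le_ofReal (Finset.sum_le_sum fun i _ => ?_)
      rw [← mul_add, ← mul_add, hc.queue_succ]
      refine mul_le_mul_of_nonneg_left ?_ (hq i)
      linarith [le_max_left (Q t ω i - S.service (H t ω) (w t ω) i) 0]
    calc ((t + 1 : ℕ) : ℝ≥0∞) * ENNReal.ofReal (∑ i, q i * lam i)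
        = t * ENNReal.ofReal (∑ i, q i * lam i) + ENNReal.ofReal (∑ i, q i * lam i) := by
          push_cast; ring
      _ ≤ (∫⁻ ω, ENNReal.ofReal (∑ i, q i * Q t ω i) ∂P + t * ∫⁻ h, S.maxWeight q h ∂ν)
          + ENNReal.ofReal (∑ i, q i * lam i) := by gcongr
      _ = (∫⁻ ω, ENNReal.ofReal (∑ i, q i * Q t ω i) ∂P + ENNReal.ofReal (∑ i, q i * lam i))
          + t * ∫⁻ h, S.maxWeight q h ∂ν := by ring
      _ ≤ (∫⁻ ω, ENNReal.ofReal (∑ i, q i * Q (t + 1) ω i) ∂P + ∫⁻ h, S.maxWeight q h ∂ν)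
          + t * ∫⁻ h, S.maxWeight q h ∂ν := by gcongr
      _ = _ := by push_cast; ring

end IsControlled

section Stabilizable

variable {K I M N : ℕ} {S : CRAN K} {ν : Measure (ChannelState K I M N)} {lam : Fin I → ℝ}

theorem Stabilizable.nonneg (hs : S.Stabilizable ν lam) (i : Fin I) : 0 ≤ lam i := by
  obtain ⟨Ω, mΩ, P, hP, 𝓖, H, A, Q, a, w, hc, -⟩ := hs
  exact hc.rate_nonneg i

/-- A necessary condition for stability: no weighted sum of the arrival rates exceeds the expected
largest weighted service. -/
theorem Stabilizable.le_lintegral_maxWeight (hs : S.Stabilizable ν lam) {q : Fin I → ℝ}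
    (hq : ∀ i, 0 ≤ q i) :
    ENNReal.ofReal (∑ i, q i * lam i) ≤ ∫⁻ h, S.maxWeight q h ∂ν := by
  obtain ⟨Ω, mΩ, P, hP, 𝓖, H, A, Q, a, w, hc, hst⟩ := hs
  by_contra! hlt
  -- The growth rate is the gap between the weighted arrival rate and the expected maximum weight.
  refine limsup_average_eq_top_of_linear_growth (tsub_pos_of_lt hlt).ne' (fun t => ?_)
    (limsup_average_const_mul_sum_lt_top Finset.univ (c := fun i => ENNReal.ofReal (q i))
      (fun i _ => ENNReal.ofReal_ne_top) fun i _ => hst i)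
  rw [ENNReal.mul_sub fun _ _ => ENNReal.natCast_ne_top t]
  exact tsub_le_iff_right.2 (hc.weighted_queue_growth hq t)

end Stabilizable

/-! ### Second moments of the queues over one slot -/

/-- Bound the squared positive part by `(q - μ) ^ 2`, and the positive part in the cross term by
`q`. The term `2 * (q * μ)` stays on the left so that every term is nonnegative and passes to
`ℝ≥0∞`. -/
theorem queue_update_sq_le {q μ α : ℝ} (hq : 0 ≤ q) (hμ : 0 ≤ μ) (hα : 0 ≤ α) :
    (max (q - μ) 0 + α) ^ 2 + 2 * (q * μ) ≤ q ^ 2 + μ ^ 2 + α ^ 2 + 2 * (q * α) := by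
  rcases max_cases (q - μ) 0 with ⟨h, h'⟩ | ⟨h, h'⟩ <;> rw [h]
  · nlinarith [mul_nonneg hμ hα]
  · nlinarith [sq_nonneg (q - μ), mul_nonneg hq hα]

namespace IsControlled

variable {K I M N : ℕ} {S : CRAN K} {ν : Measure (ChannelState K I M N)} {lam : Fin I → ℝ}
  {Ω : Type*} {mΩ : MeasurableSpace Ω} {P : Measure Ω} {𝓖 : Filtration ℕ mΩ}
  {H : ℕ → Ω → ChannelState K I M N} {A Q : ℕ → Ω → Fin I → ℝ}
  {a : ℕ → Ω → Finset (Fin K)} {w : ℕ → Ω → Beamformer K I M}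

theorem lintegral_queue_mul_arrival [IsProbabilityMeasure P]
    (hc : S.IsControlled ν lam P 𝓖 H A Q a w) (t : ℕ) (i : Fin I) :
    ∫⁻ ω, ENNReal.ofReal (Q t ω i) * ENNReal.ofReal (A t ω i) ∂P
      = ENNReal.ofReal (lam i) * ∫⁻ ω, ENNReal.ofReal (Q t ω i) ∂P := by
  have hm : Measurable fun x : Fin I → ℝ => ENNReal.ofReal (x i) :=
    (measurable_pi_apply i).ennreal_ofReal
  have h := lintegral_mul_eq_lintegral_mul_lintegral_of_indepFun
    (hc.measurable_queue_apply t i).ennreal_ofReal (hc.measurable_arrival t i).ennreal_ofReal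
    ((hc.indepFun_queue_arrival t).comp hm hm)
  rw [hc.lintegral_arrival, mul_comm (∫⁻ _, _ ∂P)] at h
  exact h

theorem lintegral_arrival_sq (hc : S.IsControlled ν lam P 𝓖 H A Q a w) (t : ℕ) (i : Fin I) :
    ∫⁻ ω, ENNReal.ofReal (A t ω i ^ 2) ∂P = ∫⁻ ω, ENNReal.ofReal (A 0 ω i ^ 2) ∂P := by
  have hm : Measurable fun x : Fin I → ℝ => ENNReal.ofReal (x i ^ 2) :=
    ((measurable_pi_apply i).pow_const 2).ennreal_ofReal
  have hA : ∀ t, Measurable (A t) := fun t => (hc.meas_arrival t).mono (𝓖.le _) le_rfl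
  rw [← lintegral_map hm (hA t), hc.law_arrival t, lintegral_map hm (hA 0)]

theorem lintegral_service_sq_le (hc : S.IsControlled ν lam P 𝓖 H A Q a w) (t : ℕ) (i : Fin I) :
    ∫⁻ ω, ENNReal.ofReal (S.service (H t ω) (w t ω) i ^ 2) ∂P
      ≤ ∫⁻ h, S.maxServiceSq i h ∂ν := by
  rw [← hc.law_channel t,
    lintegral_map (S.measurable_maxServiceSq i) (hc.measurable_channel t)]
  exact lintegral_mono fun ω => le_maxServiceSq (hc.feasible t ω) i _

/-- By independence of `Q t` and `H t` their joint law is a product, and Tonelli allows the queue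
vector to be frozen while averaging over the channel. -/
theorem lintegral_maxWeight_queue [IsProbabilityMeasure P]
    (hc : S.IsControlled ν lam P 𝓖 H A Q a w) (t : ℕ) :
    ∫⁻ ω, S.maxWeight (Q t ω) (H t ω) ∂P
      = ∫⁻ ω, ∫⁻ h, S.maxWeight (Q t ω) h ∂ν ∂P := by
  have hQ := hc.measurable_queue t
  have hH := hc.measurable_channel t
  have hν : IsProbabilityMeasure ν := by
    rw [← hc.law_channel t]; exact Measure.isProbabilityMeasure_map hH.aemeasurable
  have hPQ : IsProbabilityMeasure (P.map (Q t)) :=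
    Measure.isProbabilityMeasure_map hQ.aemeasurable
  have hm := S.measurable_maxWeight (I := I) (M := M) (N := N)
  have h1 := lintegral_map (μ := P) hm (hQ.prodMk hH)
  rw [(hc.indepFun_queue_channel t).map_prod_eq_prod_map_map hQ.aemeasurable hH.aemeasurable,
    hc.law_channel t, lintegral_prod _ hm.aemeasurable,
    lintegral_map hm.lintegral_prod_right' hQ] at h1
  exact h1.symm

/-- Gives finite first moments from finite second moments, as cancellation in `ℝ≥0∞` will require.
-/
theorem lintegral_queue_le [IsProbabilityMeasure P] (t : ℕ) (i : Fin I) :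
    ∫⁻ ω, ENNReal.ofReal (Q t ω i) ∂P ≤ 1 + ∫⁻ ω, ENNReal.ofReal (Q t ω i ^ 2) ∂P := by
  calc ∫⁻ ω, ENNReal.ofReal (Q t ω i) ∂P
      ≤ ∫⁻ ω, (1 + ENNReal.ofReal (Q t ω i ^ 2)) ∂P := by
        refine lintegral_mono fun ω => ?_
        rw [← ENNReal.ofReal_one, ← ENNReal.ofReal_add zero_le_one (sq_nonneg _)]
        exact ENNReal.ofReal_le_ofReal (by nlinarith [sq_nonneg (Q t ω i - 1)])
    _ = _ := by rw [lintegral_add_left measurable_const, lintegral_one, measure_univ]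

theorem lintegral_arrival_sq_lt_top (hc : S.IsControlled ν lam P 𝓖 H A Q a w) (i : Fin I) :
    ∫⁻ ω, ENNReal.ofReal (A 0 ω i ^ 2) ∂P < ⊤ :=
  (hc.arrival_memLp 0 i).integrable_sq.lintegral_lt_top

theorem lintegral_queue_zero_sq_lt_top (hc : S.IsControlled ν lam P 𝓖 H A Q a w) (i : Fin I) :
    ∫⁻ ω, ENNReal.ofReal (Q 0 ω i ^ 2) ∂P < ⊤ :=
  (hc.queue_zero_memLp i).integrable_sq.lintegral_lt_top

theorem lintegral_queue_sq_step [IsProbabilityMeasure P]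
    (hc : S.IsControlled ν lam P 𝓖 H A Q a w) (t : ℕ) (i : Fin I) :
    ∫⁻ ω, ENNReal.ofReal (Q (t + 1) ω i ^ 2) ∂P
      + 2 * ∫⁻ ω, ENNReal.ofReal (Q t ω i * S.service (H t ω) (w t ω) i) ∂P
      ≤ ∫⁻ ω, ENNReal.ofReal (Q t ω i ^ 2) ∂P
        + (∫⁻ h, S.maxServiceSq i h ∂ν + ∫⁻ ω, ENNReal.ofReal (A 0 ω i ^ 2) ∂P)
        + 2 * (ENNReal.ofReal (lam i) * ∫⁻ ω, ENNReal.ofReal (Q t ω i) ∂P) := by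
  have hQ := hc.measurable_queue_apply t i
  have hA := hc.measurable_arrival t i
  have hμ := hc.measurable_service t i
  have hQμ : Measurable fun ω => Q t ω i * S.service (H t ω) (w t ω) i := hQ.mul hμ
  have hQA : Measurable fun ω => ENNReal.ofReal (Q t ω i) * ENNReal.ofReal (A t ω i) :=
    hQ.ennreal_ofReal.mul hA.ennreal_ofReal
  have hsum : Measurable fun ω => ENNReal.ofReal (Q t ω i ^ 2)
      + (ENNReal.ofReal (S.service (H t ω) (w t ω) i ^ 2) + ENNReal.ofReal (A t ω i ^ 2)) :=
    (hQ.pow_const 2).ennreal_ofReal.add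
      ((hμ.pow_const 2).ennreal_ofReal.add (hA.pow_const 2).ennreal_ofReal)
  rw [← hc.lintegral_queue_mul_arrival, ← hc.lintegral_arrival_sq t,
    ← lintegral_const_mul _ hQμ.ennreal_ofReal,
    ← lintegral_const_mul _ hQA,
    ← lintegral_add_left ((hc.measurable_queue_apply (t + 1) i).pow_const 2).ennreal_ofReal]
  refine le_trans ?_ (add_le_add_left (add_le_add_right
    (add_le_add_left (hc.lintegral_service_sq_le t i) _) _) _)
  rw [← lintegral_add_left (hμ.pow_const 2).ennreal_ofReal,
    ← lintegral_add_left (hQ.pow_const 2).ennreal_ofReal,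
    ← lintegral_add_left hsum]
  refine lintegral_mono fun ω => ?_
  have h2 : (2 : ℝ≥0∞) = ENNReal.ofReal 2 := by simp
  have hq := hc.queue_nonneg t ω i
  have hs := S.service_nonneg (H t ω) (w t ω) i
  have ha := hc.arrival_nonneg t ω i
  simp only [h2]
  rw [← ENNReal.ofReal_mul hq, ← ENNReal.ofReal_mul zero_le_two, ← ENNReal.ofReal_mul zero_le_two,
    ← ENNReal.ofReal_add (by positivity) (by positivity),
    ← ENNReal.ofReal_add (by positivity) (by positivity),
    ← ENNReal.ofReal_add (by positivity) (by positivity),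
    ← ENNReal.ofReal_add (by positivity) (by positivity), hc.queue_succ]
  exact ENNReal.ofReal_le_ofReal (by linarith [queue_update_sq_le hq hs ha])

/-- A queue without arrivals does not grow. -/
theorem lintegral_queue_le_of_rate_eq_zero [IsProbabilityMeasure P]
    (hc : S.IsControlled ν lam P 𝓖 H A Q a w) {i : Fin I} (hi : lam i = 0) (t : ℕ) :
    ∫⁻ ω, ENNReal.ofReal (Q t ω i) ∂P ≤ ∫⁻ ω, ENNReal.ofReal (Q 0 ω i) ∂P := by
  induction t with
  | zero => exact le_rfl
  | succ t ih =>
    refine le_trans (lintegral_mono_ae ?_) ih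
    have h := hc.lintegral_arrival t i
    rw [hi, ENNReal.ofReal_zero,
      lintegral_eq_zero_iff (hc.measurable_arrival t i).ennreal_ofReal] at h
    filter_upwards [h] with ω hω
    have hA : A t ω i = 0 := le_antisymm (ENNReal.ofReal_eq_zero.1 hω) (hc.arrival_nonneg t ω i)
    rw [hc.queue_succ, hA, add_zero]
    refine ENNReal.ofReal_le_ofReal (max_le ?_ (hc.queue_nonneg t ω i))
    linarith [S.service_nonneg (H t ω) (w t ω) i]

end IsControlled

/-! ### Drift and stability under the per-slot optimal control -/

namespace IsP1Controlled

variable {K I M N : ℕ} {S : CRAN K} {V : ℝ} {ν : Measure (ChannelState K I M N)}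
  {lam lam' : Fin I → ℝ}
  {Ω : Type*} {mΩ : MeasurableSpace Ω} {P : Measure Ω} {𝓖 : Filtration ℕ mΩ}
  {H : ℕ → Ω → ChannelState K I M N} {A Q : ℕ → Ω → Fin I → ℝ}
  {a : ℕ → Ω → Finset (Fin K)} {w : ℕ → Ω → Beamformer K I M}

/-- The control serves, up to a constant, at least as much queue-weighted traffic as any vector of
rates that can be stabilized. -/
theorem sum_rate_mul_queue_le [IsProbabilityMeasure P]
    (hc : S.IsP1Controlled V ν lam P 𝓖 H A Q a w) (hV : 0 ≤ V)
    (hs : S.Stabilizable ν lam') (t : ℕ) :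
    ∑ i, ENNReal.ofReal (lam' i) * ∫⁻ ω, ENNReal.ofReal (Q t ω i) ∂P
      ≤ ∑ i, ∫⁻ ω, ENNReal.ofReal (Q t ω i * S.service (H t ω) (w t ω) i) ∂P
        + ENNReal.ofReal (V * S.maxPower) := by
  have hQ := hc.queue_nonneg t
  calc ∑ i, ENNReal.ofReal (lam' i) * ∫⁻ ω, ENNReal.ofReal (Q t ω i) ∂P
      = ∫⁻ ω, ENNReal.ofReal (∑ i, Q t ω i * lam' i) ∂P := by
        simp_rw [ENNReal.ofReal_sum_of_nonneg fun i _ => mul_nonneg (hQ _ i) (hs.nonneg i),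
          fun i => mul_comm _ (lam' i), fun i => ENNReal.ofReal_mul (hs.nonneg i)]
        rw [lintegral_finsetSum _ fun i _ =>
          (hc.measurable_queue_apply t i).ennreal_ofReal.const_mul _]
        exact Finset.sum_congr rfl fun i _ =>
          (lintegral_const_mul _ (hc.measurable_queue_apply t i).ennreal_ofReal).symm
    -- The necessary condition for `lam'` holds for all nonnegative weights, so the current queue
    -- vector may serve as weights for each `ω`.
    _ ≤ ∫⁻ ω, ∫⁻ h, S.maxWeight (Q t ω) h ∂ν ∂P :=
        lintegral_mono fun ω => hs.le_lintegral_maxWeight (hQ ω)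
    _ = ∫⁻ ω, S.maxWeight (Q t ω) (H t ω) ∂P := (hc.lintegral_maxWeight_queue t).symm
    _ ≤ ∫⁻ ω, (ENNReal.ofReal (∑ i, Q t ω i * S.service (H t ω) (w t ω) i)
          + ENNReal.ofReal (V * S.maxPower)) ∂P :=
        lintegral_mono fun ω => (hc.optimal t ω).maxWeight_le hV
    _ = _ := by
        rw [lintegral_add_right _ measurable_const, lintegral_const, measure_univ, mul_one]
        simp_rw [ENNReal.ofReal_sum_of_nonneg fun i _ =>
          mul_nonneg (hQ _ i) (S.service_nonneg _ _ i)]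
        have hm : ∀ i, Measurable fun ω => Q t ω i * S.service (H t ω) (w t ω) i := fun i =>
          (hc.measurable_queue_apply t i).mul (hc.measurable_service t i)
        rw [lintegral_finsetSum _ fun i _ => (hm i).ennreal_ofReal]

/-- Drift inequality: the mean sum of squared queue lengths satisfies a Foster–Lyapunov bound. -/
theorem drift [IsProbabilityMeasure P] (hc : S.IsP1Controlled V ν lam P 𝓖 H A Q a w)
    (hV : 0 ≤ V) (hs : S.Stabilizable ν lam') (t : ℕ) :
    ∑ i, ∫⁻ ω, ENNReal.ofReal (Q (t + 1) ω i ^ 2) ∂P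
      + 2 * ∑ i, ENNReal.ofReal (lam' i) * ∫⁻ ω, ENNReal.ofReal (Q t ω i) ∂P
      ≤ ∑ i, ∫⁻ ω, ENNReal.ofReal (Q t ω i ^ 2) ∂P
        + (∑ i, (∫⁻ h, S.maxServiceSq i h ∂ν + ∫⁻ ω, ENNReal.ofReal (A 0 ω i ^ 2) ∂P)
          + 2 * ENNReal.ofReal (V * S.maxPower))
        + 2 * ∑ i, ENNReal.ofReal (lam i) * ∫⁻ ω, ENNReal.ofReal (Q t ω i) ∂P := by
  have h1 := Finset.sum_le_sum fun i (_ : i ∈ Finset.univ) => hc.lintegral_queue_sq_step t i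
  simp only [Finset.sum_add_distrib, ← Finset.mul_sum] at h1 ⊢
  refine (add_le_add_right (mul_le_mul_right (hc.sum_rate_mul_queue_le hV hs t) 2) _).trans ?_
  rw [mul_add, ← add_assoc]
  refine (add_le_add_left h1 _).trans (le_of_eq ?_)
  ring

/-- Telescoping the drift leaves the initial Lyapunov value as `C` and the one-slot constant as `B`.
-/
theorem exists_drift_bound [IsProbabilityMeasure P]
    (hc : S.IsP1Controlled V ν lam P 𝓖 H A Q a w) (hV : 0 ≤ V) (hν : S.FiniteServiceMoments ν)
    (hs : S.Stabilizable ν lam') (hle : ∀ i, lam i ≤ lam' i) :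
    ∃ C B : ℝ≥0∞, C ≠ ⊤ ∧ B ≠ ⊤ ∧ ∀ T : ℕ, ∑ t ∈ Finset.range T,
      ∑ i, ENNReal.ofReal (lam' i - lam i) * ∫⁻ ω, ENNReal.ofReal (Q t ω i) ∂P ≤ C + T * B := by
  set B := ∑ i, (∫⁻ h, S.maxServiceSq i h ∂ν + ∫⁻ ω, ENNReal.ofReal (A 0 ω i ^ 2) ∂P)
          + 2 * ENNReal.ofReal (V * S.maxPower) with hB
  set L : ℕ → ℝ≥0∞ := fun t => ∑ i, ∫⁻ ω, ENNReal.ofReal (Q t ω i ^ 2) ∂P with hL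
  set X : ℕ → ℝ≥0∞ := fun t =>
    ∑ i, ENNReal.ofReal (lam i) * ∫⁻ ω, ENNReal.ofReal (Q t ω i) ∂P with hX
  set D : ℕ → ℝ≥0∞ := fun t =>
    ∑ i, ENNReal.ofReal (lam' i - lam i) * ∫⁻ ω, ENNReal.ofReal (Q t ω i) ∂P with hD
  have hBtop : B ≠ ⊤ := by
    refine ENNReal.add_ne_top.2 ⟨ENNReal.sum_ne_top.2 fun i _ => ENNReal.add_ne_top.2
      ⟨(hν i).ne, (hc.lintegral_arrival_sq_lt_top i).ne⟩, ENNReal.mul_ne_top ?_ ?_⟩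
    · exact ENNReal.ofNat_ne_top
    · exact ENNReal.ofReal_ne_top
  have hXD : ∀ t, ∑ i, ENNReal.ofReal (lam' i) * ∫⁻ ω, ENNReal.ofReal (Q t ω i) ∂P
      = X t + D t := fun t => by
    rw [hX, hD, ← Finset.sum_add_distrib]
    refine Finset.sum_congr rfl fun i _ => ?_
    rw [← add_mul, ← ENNReal.ofReal_add (hc.rate_nonneg i) (sub_nonneg.2 (hle i)),
      add_sub_cancel]
  have hstep : ∀ t, L (t + 1) + 2 * (X t + D t) ≤ L t + B + 2 * X t := fun t => by
    rw [← hXD]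
    exact hc.drift hV hs t
  have hXtop : ∀ t, L t ≠ ⊤ → X t ≠ ⊤ := fun t ht => by
    refine ENNReal.sum_ne_top.2 fun i hi => ENNReal.mul_ne_top ENNReal.ofReal_ne_top ?_
    exact ne_top_of_le_ne_top
      (ENNReal.add_ne_top.2 ⟨ENNReal.one_ne_top, (ENNReal.sum_ne_top.1 ht) i hi⟩)
      (IsControlled.lintegral_queue_le t i)
  -- Finiteness propagates through the drift inequality itself: a finite `L t` makes `X t` finite,
  -- which bounds `L (t + 1)`.
  have hLtop : ∀ t, L t ≠ ⊤ := fun t => by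
    induction t with
    | zero => exact ENNReal.sum_ne_top.2 fun i _ => (hc.lintegral_queue_zero_sq_lt_top i).ne
    | succ t ih =>
      refine ne_top_of_le_ne_top ?_ (le_self_add.trans (hstep t))
      exact ENNReal.add_ne_top.2 ⟨ENNReal.add_ne_top.2 ⟨ih, hBtop⟩,
        ENNReal.mul_ne_top ENNReal.ofNat_ne_top (hXtop t ih)⟩
  -- Cancelling `2 * X t` is legitimate because it is finite; one of the two copies of `D t` is
  -- discarded.
  have hstep' : ∀ t, L (t + 1) + D t ≤ L t + B := fun t => by
    have h2X : 2 * X t ≠ ⊤ := ENNReal.mul_ne_top ENNReal.ofNat_ne_top (hXtop t (hLtop t))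
    refine (ENNReal.add_le_add_iff_right h2X).1 (le_trans ?_ (hstep t))
    calc L (t + 1) + D t + 2 * X t ≤ L (t + 1) + 2 * D t + 2 * X t := by
          gcongr
          exact le_mul_of_one_le_left' one_le_two
      _ = L (t + 1) + 2 * (X t + D t) := by ring
  refine ⟨L 0, B, hLtop 0, hBtop, fun T => ?_⟩
  have key : L T + ∑ t ∈ Finset.range T, D t ≤ L 0 + T * B := by
    induction T with
    | zero => simp
    | succ T ih =>
      rw [Finset.sum_range_succ]
      calc L (T + 1) + (∑ t ∈ Finset.range T, D t + D T)
          = L (T + 1) + D T + ∑ t ∈ Finset.range T, D t := by ring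
        _ ≤ L T + B + ∑ t ∈ Finset.range T, D t := add_le_add_left (hstep' T) _
        _ = L T + ∑ t ∈ Finset.range T, D t + B := by ring
        _ ≤ L 0 + T * B + B := by gcongr
        _ = L 0 + (T + 1 : ℕ) * B := by push_cast; ring
  exact le_add_self.trans key

/-- If `lam'` can be stabilized, the control stabilizes every queue whose arrival rate is below
that in `lam'` or zero. -/
theorem stronglyStable [IsProbabilityMeasure P]
    (hc : S.IsP1Controlled V ν lam P 𝓖 H A Q a w) (hV : 0 ≤ V) (hν : S.FiniteServiceMoments ν)
    (hs : S.Stabilizable ν lam') (hlt : ∀ i, lam i < lam' i ∨ lam i = 0) :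
    StronglyStable P Q := by
  have hle : ∀ i, lam i ≤ lam' i := fun i =>
    (hlt i).elim le_of_lt fun h => h ▸ hs.nonneg i
  obtain ⟨C, B, hC, hB, hCB⟩ := hc.exists_drift_bound hV hν hs hle
  intro i
  rw [limsup_average_lt_top_iff]
  rcases hlt i with hi | hi
  · set d := ENNReal.ofReal (lam' i - lam i) with hd
    have hd0 : d ≠ 0 := (ENNReal.ofReal_pos.2 (sub_pos.2 hi)).ne'
    have hdtop : d ≠ ⊤ := ENNReal.ofReal_ne_top
    refine ⟨d⁻¹ * (C + B), ENNReal.mul_ne_top (ENNReal.inv_ne_top.2 hd0)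
      (ENNReal.add_ne_top.2 ⟨hC, hB⟩), ?_⟩
    -- For `T ≥ 1` the constant `C` is absorbed into `C * T`.
    filter_upwards [eventually_ge_atTop 1] with T hT
    rw [mul_assoc, ← ENNReal.mul_le_iff_le_inv hd0 hdtop, Finset.mul_sum, add_mul, mul_comm B]
    refine (Finset.sum_le_sum fun t _ => ?_).trans ((hCB T).trans ?_)
    · exact Finset.single_le_sum (f := fun i =>
        ENNReal.ofReal (lam' i - lam i) * ∫⁻ ω, ENNReal.ofReal (Q t ω i) ∂P)
        (fun _ _ => zero_le) (Finset.mem_univ i)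
    · gcongr
      exact le_mul_of_one_le_right' (by exact_mod_cast hT)
  -- The drift bound may give nothing at rate zero, but without arrivals the mean queue never
  -- exceeds its initial value.
  · refine ⟨∫⁻ ω, ENNReal.ofReal (Q 0 ω i) ∂P, ne_top_of_le_ne_top (ENNReal.add_ne_top.2
      ⟨ENNReal.one_ne_top, (hc.lintegral_queue_zero_sq_lt_top i).ne⟩)
      (IsControlled.lintegral_queue_le 0 i), Eventually.of_forall fun T => ?_⟩
    refine (Finset.sum_le_sum fun t _ =>
      hc.lintegral_queue_le_of_rate_eq_zero hi t).trans_eq ?_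
    rw [Finset.sum_const, Finset.card_range, nsmul_eq_mul, mul_comm]

end IsP1Controlled

/-! ### Comparison of the stability regions -/

section Region

variable {K I M N : ℕ} {S : CRAN K} {V : ℝ} {ν : Measure (ChannelState K I M N)}
  {lam : Fin I → ℝ}

theorem StabilizedByP1.stabilizable (h : S.StabilizedByP1 V ν lam) : S.Stabilizable ν lam := by
  obtain ⟨⟨Ω, mΩ, P, hP, 𝓖, H, A, Q, a, w, hc⟩, hst⟩ := h
  exact ⟨Ω, mΩ, P, hP, 𝓖, H, A, Q, a, w, hc.toIsControlled,
    hst Ω mΩ P hP 𝓖 H A Q a w hc⟩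

/-- Scaling, unlike subtracting a constant, keeps the rates nonnegative; each coordinate strictly
decreases or is zero, the two cases that `stronglyStable` admits. -/
theorem Stabilizable.stabilizedByP1_smul [IsProbabilityMeasure ν] (hs : S.Stabilizable ν lam)
    (hV : 0 ≤ V) (hν : S.FiniteServiceMoments ν) {r : ℝ} (hr0 : 0 ≤ r) (hr1 : r < 1) :
    S.StabilizedByP1 V ν (r • lam) := by
  refine ⟨S.exists_isP1Controlled V ν fun i => mul_nonneg hr0 (hs.nonneg i), ?_⟩
  intro Ω mΩ P hP 𝓖 H A Q a w hc
  refine hc.stronglyStable hV hν hs fun i => ?_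
  rcases (hs.nonneg i).eq_or_lt with h | h
  · exact Or.inr (by simp [← h])
  · exact Or.inl (mul_lt_of_lt_one_left h hr1)

theorem closure_stabilizedByP1 [IsProbabilityMeasure ν] (hV : 0 ≤ V)
    (hν : S.FiniteServiceMoments ν) :
    closure {lam | S.StabilizedByP1 V ν lam} = S.stabilityRegion ν := by
  refine (closure_mono fun lam h => StabilizedByP1.stabilizable h).antisymm
    (closure_minimal (fun lam hs => ?_) isClosed_closure)
  have hlim : Tendsto (fun r : ℝ => r • lam) (nhdsWithin 1 (Set.Iio 1)) (nhds lam) := by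
    have h : Tendsto (fun r : ℝ => r • lam) (nhds 1) (nhds ((1 : ℝ) • lam)) :=
      (continuous_id.smul continuous_const).tendsto 1
    rw [one_smul] at h
    exact h.mono_left nhdsWithin_le_nhds
  refine mem_closure_of_tendsto hlim ?_
  filter_upwards [Ioo_mem_nhdsLT zero_lt_one] with r hr
  exact Stabilizable.stabilizedByP1_smul hs hV hν hr.1.le hr.2

end Region

end CRAN

theorem theorem2 {K I M N : ℕ} (S : CRAN K) (V : ℝ) (hV : 0 < V)
    (ν : Measure (ChannelState K I M N)) [IsProbabilityMeasure ν]
    (hν : S.FiniteServiceMoments ν) :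
    closure {lam | S.StabilizedByP1 V ν lam} = S.stabilityRegion ν ∧
    ∀ (lam : Fin I → ℝ), (∃ ε : ℝ, 0 < ε ∧ (fun i => lam i + ε) ∈ S.stabilityRegion ν) →
      ∀ {Ω : Type*} {mΩ : MeasurableSpace Ω} (P : Measure Ω) [IsProbabilityMeasure P]
        (𝓖 : Filtration ℕ mΩ) (H : ℕ → Ω → ChannelState K I M N) (A Q : ℕ → Ω → Fin I → ℝ)
        (a : ℕ → Ω → Finset (Fin K)) (w : ℕ → Ω → Beamformer K I M),
        S.IsP1Controlled V ν lam P 𝓖 H A Q a w → CRAN.StronglyStable P Q := by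
  refine ⟨CRAN.closure_stabilizedByP1 hV.le hν, ?_⟩
  rintro lam ⟨ε, hε, hmem⟩ Ω mΩ P hP 𝓖 H A Q a w hc
  -- A stabilizable `lam'` within `ε` of `lam + ε` in the sup distance lies strictly above `lam` in
  -- every coordinate.
  obtain ⟨lam', hs, hdist⟩ := Metric.mem_closure_iff.1 hmem ε hε
  refine hc.stronglyStable hV.le hν hs fun i => Or.inl ?_
  have h := (dist_le_pi_dist (fun i => lam i + ε) lam' i).trans_lt hdist
  rw [Real.dist_eq] at h
  linarith [(abs_lt.1 h).2]
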